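/- Let $n\ge 2$ and let $\mathcal C_n$ be the simplicial complex on the vertex set $\{1,\dots,2n+1\}$ whose minimal non-faces are $\{i,n+i\}$, $\{i,2n+1\}$ $(1\le i\le n)$ and $\{n+1,\dots,2n\}$. A fan over $\mathcal C_n$ is a map $i\mapsto \mathbf v_i\in\mathbb Z^n$ on the vertices such that, for all faces $I,J$ of $\mathcal C_n$, the vectors $\mathbf v_i$ $(i\in I)$ are linearly independent over $\mathbb R$ and $\mathrm{cone}(I)\cap\mathrm{cone}(J)=\mathrm{cone}(I\cap J)$, where $\mathrm{cone}(I)=\{\sum_{i\in I}\alpha_i\mathbf v_i \mid \alpha_i\ge 0\}\subset\mathbb R^n$. It is complete if the cones of the faces cover $\mathbb R^n$, and nonsingular if for every face $I$ the vectors $\mathbf v_i$ $(i\in I)$ form a part of a basis of $\mathbb Z^n$. For every complete nonsingular fan over $\mathcal C_n$ there is a unique pair $(A,\mathbf b)$ of an $n\times n$ integer matrix $A$ and a vector $\mathbf b\in\mathbb Z^n$ with $$(\mathbf v_{n+1},\dots,\mathbf v_{2n})=-(\mathbf v_1,\dots,\mathbf v_n)A,\qquad \mathbf v_{2n+1}=-(\mathbf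 v_1,\dots,\mathbf v_n)\mathbf b .$$ For integers $a_1,\dots,a_n$ let $C(a_1,\dots,a_n)$ be the $n\times n$ matrix with diagonal entries $1$, with $(1,n)$-entry $a_1$, with $(i,i-1)$-entry $a_i$ for $2\le i\le n$, and with all other entries $0$. Then there is a permutation $\sigma$ of $\{1,\dots,n\}$ such that, after $(A,\mathbf b)$ is replaced by the pair $(A_\sigma,\mathbf b_\sigma)$, where $(A_\sigma)_{ij}=A_{\sigma(i)\sigma(j)}$ and $(\mathbf b_\sigma)_i=b_{\sigma(i)}$, one of the following holds; here $\mathbf a_i$ denotes the $i$-th column of the (new) matrix $A$. - Type 0: $\det A=0$, $A=C(-1,\dots,-1)$, and $\sum_{i=1}^n b_i=1$. - Type 1: $\det A=1$, $A$ is lower triangular with all diagonal entries $1$, and $\mathbf b=\sum_{i=1}^n\mathbf a_i$. - Type 2: $\det A=2$, $A=C(a_1,\dots,a_n)$ with all $a_i=\pm1$ and an odd number of the $a_i$ equal to $1$, and $\mathbf b=\frac12\sum_{i=1}^n\mathbf a_i$. - Type 3: $\det A\ne 0,1,2$, $A=C(a,-1,\dots,-1)$ for an integer $a\ne 0,\pm1$,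 and $\mathbf b=\frac1{\det A}\sum_{i=1}^n\mathbf a_i=(1,0,\dots,0)^T$. -/

import Mathlib

namespace CutCube

open Matrix

/-- The cone in `ℝⁿ` spanned by the integer vectors `v i`, `i ∈ I`; for `I = ∅` it is `{0}`. -/
def cone {ι : Type*} {n : ℕ} (v : ι → Fin n → ℤ) (I : Finset ι) : Set (Fin n → ℝ) :=
  {x | ∃ α : ι → ℝ, (∀ i ∈ I, 0 ≤ α i) ∧ x = ∑ i ∈ I, α i • (fun k => (v i k : ℝ))}

/-- A (simplicial) fan of dimension `n`: a pair `(K, V)` of an abstract simplicial complex `K` on a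
vertex set `ι` and a map `V : ι → ℤⁿ`. The faces in Mathlib's complexes are nonempty; the empty
face would add nothing to the two conditions. -/
structure SimplicialFan (ι : Type*) [DecidableEq ι] (n : ℕ) where
  complex : PreAbstractSimplicialComplex ι
  vec : ι → Fin n → ℤ
  linearIndependent : ∀ I ∈ complex,
    LinearIndependent ℝ (fun i : I => (fun k => (vec i k : ℝ) : Fin n → ℝ))
  cone_inter : ∀ I ∈ complex, ∀ J ∈ complex, cone vec I ∩ cone vec J = cone vec (I ∩ J)

namespace SimplicialFan

variable {ι : Type*} [DecidableEq ι] {n : ℕ}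

/-- The cones of the fan cover `ℝⁿ`. -/
def IsComplete (Δ : SimplicialFan ι n) : Prop :=
  ⋃ I ∈ Δ.complex, cone Δ.vec I = Set.univ

/-- For every face `I`, the vectors `vec i`, `i ∈ I`, form a part of a basis of `ℤⁿ`. -/
def IsNonsingular (Δ : SimplicialFan ι n) : Prop :=
  ∀ I ∈ Δ.complex, ∃ (B : Module.Basis (Fin n) ℤ (Fin n → ℤ)) (e : ι → Fin n),
    Set.InjOn e (I : Set ι) ∧ ∀ i ∈ I, B (e i) = Δ.vec i

end SimplicialFan

/-- The `2n+1` vertices of `C_n`. -/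
abbrev Vertex (n : ℕ) : Type := Fin n ⊕ Fin n ⊕ Unit

/-- The vertex labelled `i` (`1 ≤ i ≤ n`). -/
abbrev low {n : ℕ} (i : Fin n) : Vertex n := Sum.inl i

/-- The vertex labelled `n + i` (`1 ≤ i ≤ n`). -/
abbrev high {n : ℕ} (i : Fin n) : Vertex n := Sum.inr (Sum.inl i)

/-- The vertex labelled `2n + 1`. -/
abbrev cut {n : ℕ} : Vertex n := Sum.inr (Sum.inr ())

/-- The simplicial complex `C_n` whose minimal non-faces are `{i, n+i}` and `{i, 2n+1}`
(`1 ≤ i ≤ n`), and `{n+1, …, 2n}`: the faces are the nonempty sets that contain none of these. -/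
def cutCubeComplex (n : ℕ) : PreAbstractSimplicialComplex (Vertex n) where
  faces := {s | s.Nonempty ∧ (∀ i : Fin n, ¬ ({low i, high i} : Finset (Vertex n)) ⊆ s) ∧
    (∀ i : Fin n, ¬ ({low i, cut} : Finset (Vertex n)) ⊆ s) ∧
    ¬ (Finset.univ.image high : Finset (Vertex n)) ⊆ s}
  isRelLowerSet_faces := by
    rintro s ⟨hs, h1, h2, h3⟩
    exact ⟨hs, fun t hts ht => ⟨ht, fun i h => h1 i (h.trans hts), fun i h => h2 i (h.trans hts),
      fun h => h3 (h.trans hts)⟩⟩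

/-- The pair `(A, b)` is associated with the vectors `v_1, …, v_{2n+1}`:
`(v_{n+1}, …, v_{2n}) = -(v_1, …, v_n) A` and `v_{2n+1} = -(v_1, …, v_n) b`. -/
def IsAssociated {n : ℕ} (v : Vertex n → Fin n → ℤ)
    (A : Matrix (Fin n) (Fin n) ℤ) (b : Fin n → ℤ) : Prop :=
  (∀ j, v (high j) = -∑ i, A i j • v (low i)) ∧ v cut = -∑ i, b i • v (low i)

/-- The matrix with diagonal entries `1`, with `a_1` in position `(1, n)`, with `a_i` in position
`(i, i-1)` for `2 ≤ i ≤ n`, and with all other entries `0` (meant for `n ≥ 2`). -/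
def cyclicMatrix {n : ℕ} (a : Fin n → ℤ) : Matrix (Fin n) (Fin n) ℤ :=
  Matrix.of fun i j =>
    if i = j then 1 else if ((j : ℕ) + 1) % n = (i : ℕ) then a i else 0

/-- `b = (1/q) ∑ⱼ aⱼ`, where `aⱼ` is the `j`-th column of `A`. -/
def IsColumnSumDiv {n : ℕ} (A : Matrix (Fin n) (Fin n) ℤ) (b : Fin n → ℤ) (q : ℤ) : Prop :=
  ∀ i, (b i : ℚ) = (1 / (q : ℚ)) * ∑ j, (A i j : ℚ)

/-- Type 0. -/
def IsTypeZero {n : ℕ} (A : Matrix (Fin n) (Fin n) ℤ) (b : Fin n → ℤ) : Prop :=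
  A.det = 0 ∧ A = cyclicMatrix (fun _ => -1) ∧ ∑ i, b i = 1

/-- Type 1. -/
def IsTypeOne {n : ℕ} (A : Matrix (Fin n) (Fin n) ℤ) (b : Fin n → ℤ) : Prop :=
  A.det = 1 ∧ (∀ i, A i i = 1) ∧ (∀ i j, i < j → A i j = 0) ∧ ∀ i, b i = ∑ j, A i j

/-- Type 2. -/
def IsTypeTwo {n : ℕ} (A : Matrix (Fin n) (Fin n) ℤ) (b : Fin n → ℤ) : Prop :=
  A.det = 2 ∧ ∃ a : Fin n → ℤ, (∀ i, a i = 1 ∨ a i = -1) ∧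
    Odd (Finset.univ.filter fun i => a i = 1).card ∧ A = cyclicMatrix a ∧ IsColumnSumDiv A b 2

/-- Type 3: here `a_1 = a` is the `(1, n)` entry, `a_2 = ⋯ = a_n = -1`, and `b = e_1`. -/
def IsTypeThree {n : ℕ} (A : Matrix (Fin n) (Fin n) ℤ) (b : Fin n → ℤ) : Prop :=
  (A.det ≠ 0 ∧ A.det ≠ 1 ∧ A.det ≠ 2) ∧
    (∃ a : ℤ, a ≠ 0 ∧ a ≠ 1 ∧ a ≠ -1 ∧
      A = cyclicMatrix (fun i => if (i : ℕ) = 0 then a else -1)) ∧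
    IsColumnSumDiv A b A.det ∧ ∀ i, b i = if (i : ℕ) = 0 then 1 else 0

end CutCube

namespace CutCube

open Matrix

/-! Nonsingularity makes the determinant of every facet `±1`, and two facets sharing a wall lie on
opposite sides of it, so their determinants are opposite (`facetDet_update`). A proper subset `I` of
the indices gives the facet with `high` on `I` and `low` elsewhere. Crossing `|I|` walls from the
all-`low` facet shows that the principal minor of `A` on `I` is `1`. One more wall, into a facet
containing `cut`, shows that all Cramer numerators of `A x = b` are `1`; hence the row sums of `A`
are `det A * b`.

The minors determine the shape of `A`. Draw an arrow between distinct indices for each nonzero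
off-diagonal entry. Without a directed cycle, a suitable order makes `A` triangular: Type 1.
Otherwise a chordless cycle carries a cyclic submatrix with nonzero entries, whose determinant is
not `1`; so the cycle is everything and `A` is cyclic.

For cyclic `A` with `q = det A`, the row sums read `1 + a i = q * b i`, and the determinant formula
becomes `∏ (1 - q * b i) = 1 - q`. The values `q = 0, 2` give Types 0 and 2. For any other `q`,
comparing sizes forces one factor to be `1 - q` and the rest `±1`: one `b i` is `1`, and `a j = ±1`
elsewhere. A value `a j = 1` there would put the vector of `cut` in the cone of a facet avoiding
`cut`, so Type 3 remains. -/

/-! ### Cones and adjacent facets of a fan -/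

theorem sum_image_extend {ι κ : Type*} [DecidableEq ι] [Fintype κ] {n : ℕ} (v : ι → Fin n → ℤ)
    {f : κ → ι} (hf : f.Injective) (γ : κ → ℤ) :
    ∑ i ∈ Finset.univ.image f,
      Function.extend f (fun j => (γ j : ℝ)) 0 i • (fun k => (v i k : ℝ) : Fin n → ℝ) =
    fun k => (((∑ j, γ j • v (f j)) k : ℤ) : ℝ) := by
  rw [Finset.sum_image hf.injOn]
  ext k
  simp [Finset.sum_apply, hf.extend_apply]

theorem mem_cone_image {ι κ : Type*} [DecidableEq ι] [Fintype κ] {n : ℕ} (v : ι → Fin n → ℤ)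
    {f : κ → ι} (hf : f.Injective) {γ : κ → ℤ} (hγ : ∀ j, 0 ≤ γ j) {y : Fin n → ℤ}
    (hy : y = ∑ j, γ j • v (f j)) :
    (fun k => (y k : ℝ)) ∈ cone v (Finset.univ.image f) := by
  refine ⟨Function.extend f (fun j => (γ j : ℝ)) 0, ?_, ?_⟩
  · intro i hi
    obtain ⟨j, -, rfl⟩ := Finset.mem_image.1 hi
    rw [hf.extend_apply]
    exact_mod_cast hγ j
  · rw [sum_image_extend v hf γ, hy]

namespace SimplicialFan

variable {ι : Type*} [DecidableEq ι] {n : ℕ}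

theorem coeff_eq (Δ : SimplicialFan ι n) {I : Finset ι} (hI : I ∈ Δ.complex) {α β : ι → ℝ}
    (h : ∑ i ∈ I, α i • (fun k => (Δ.vec i k : ℝ) : Fin n → ℝ) =
      ∑ i ∈ I, β i • (fun k => (Δ.vec i k : ℝ) : Fin n → ℝ)) {i : ι} (hi : i ∈ I) :
    α i = β i := by
  have hli : LinearIndepOn ℝ (fun i => (fun k => (Δ.vec i k : ℝ) : Fin n → ℝ)) (I : Set ι) :=
    Δ.linearIndependent I hI
  have := linearIndepOn_finset_iff.1 hli (fun i => α i - β i)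
    (by simp only [sub_smul, Finset.sum_sub_distrib, h, sub_self]) i hi
  exact sub_eq_zero.1 this

/-- Two facets that share a wall lie on opposite sides of it. -/
theorem wall_coeff_nonpos (Δ : SimplicialFan ι n) {f : Fin n → ι} (hf : f.Injective) {k : Fin n}
    {x : ι} (hx : ∀ j, f j ≠ x) (hF : Finset.univ.image f ∈ Δ.complex)
    (hF' : Finset.univ.image (Function.update f k x) ∈ Δ.complex) {t : Fin n → ℤ}
    (ht : Δ.vec x = ∑ j, t j • Δ.vec (f j)) : t k ≤ 0 := by
  by_contra! htk
  set f' := Function.update f k x with hf'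
  have hf'k : f' k = x := by simp [hf']
  have hf'j : ∀ j, j ≠ k → f' j = f j := fun j hj => by simp [hf', hj]
  have hinj : f'.Injective := by
    intro i j hij
    by_cases hi : i = k <;> by_cases hj : j = k
    · rw [hi, hj]
    · subst hi; rw [hf'k, hf'j j hj] at hij; exact absurd hij.symm (hx j)
    · subst hj; rw [hf'k, hf'j i hi] at hij; exact absurd hij (hx i)
    · rw [hf'j i hi, hf'j j hj] at hij; exact hf hij
  -- The vector `y` is that of `x` plus `|t j|` times each wall vector, so its coordinates are
  -- nonnegative in both facets. Its coordinate at `x` is `1`, but the common cone does not involve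
  -- `x`.
  let γ : Fin n → ℤ := fun j => if j = k then t k else t j + |t j|
  let γ' : Fin n → ℤ := fun j => if j = k then 1 else |t j|
  let y : Fin n → ℤ := ∑ j, γ' j • Δ.vec (f' j)
  have hy : y = ∑ j, γ j • Δ.vec (f j) := by
    have h1 : ∀ j, γ' j • Δ.vec (f' j) =
        (if j = k then Δ.vec x else 0) + (γ j • Δ.vec (f j) - t j • Δ.vec (f j)) := by
      intro j
      by_cases hj : j = k
      · subst hj; simp [γ, γ', hf'k]
      · simp [γ, γ', hj, hf'j j hj, add_smul]
    simp only [y, h1, Finset.sum_add_distrib, Finset.sum_sub_distrib, Finset.sum_ite_eq',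
      Finset.mem_univ, if_true, ← ht]
    abel
  have m1 := mem_cone_image Δ.vec hf (γ := γ) (fun j => by
    by_cases hj : j = k
    · simp [γ, hj, htk.le]
    · simp only [γ, hj, if_false]; linarith [neg_abs_le (t j)]) hy
  have m2 := mem_cone_image Δ.vec hinj (γ := γ') (fun j => by
    by_cases hj : j = k <;> simp [γ', hj]) (y := y) rfl
  have m3 : (fun i => (y i : ℝ)) ∈
      cone Δ.vec (Finset.univ.image f ∩ Finset.univ.image f') := by
    rw [← Δ.cone_inter _ hF _ hF']; exact ⟨m1, m2⟩
  obtain ⟨α, -, hα⟩ := m3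
  have hxn : x ∉ Finset.univ.image f ∩ Finset.univ.image f' := by
    simp only [Finset.mem_inter, Finset.mem_image, not_and]
    rintro ⟨j, -, hj⟩
    exact absurd hj (hx j)
  have hc := Δ.coeff_eq hF' (α := Function.extend f' (fun j => (γ' j : ℝ)) 0)
    (β := fun i => if i ∈ Finset.univ.image f ∩ Finset.univ.image f' then α i else 0) (i := x) (by
      rw [sum_image_extend Δ.vec hinj γ', hα]
      simp only [ite_smul, zero_smul]
      rw [← Finset.sum_filter]
      refine Finset.sum_congr ?_ fun _ _ => rfl
      ext i
      simp only [Finset.mem_filter, Finset.mem_inter]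
      tauto) (Finset.mem_image.2 ⟨k, Finset.mem_univ _, hf'k⟩)
  rw [if_neg hxn, ← hf'k, hinj.extend_apply] at hc
  simp [γ'] at hc

/-- The determinant of the matrix whose rows are the vectors of a facet. -/
def facetDet (Δ : SimplicialFan ι n) (f : Fin n → ι) : ℤ :=
  (Matrix.of fun j => Δ.vec (f j)).det

theorem exists_basis_of_facet {Δ : SimplicialFan ι n} (hΔ : Δ.IsNonsingular) {f : Fin n → ι}
    (hf : f.Injective) (hF : Finset.univ.image f ∈ Δ.complex) :
    ∃ B : Module.Basis (Fin n) ℤ (Fin n → ℤ), ∀ j, B j = Δ.vec (f j) := by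
  obtain ⟨B, e, he, hB⟩ := hΔ _ hF
  have hmem : ∀ j, f j ∈ Finset.univ.image f := fun j =>
    Finset.mem_image_of_mem f (Finset.mem_univ j)
  have hinj : Function.Injective (e ∘ f) := fun i j hij => hf (he (hmem i) (hmem j) hij)
  let E := Equiv.ofBijective _ (Finite.injective_iff_bijective.1 hinj)
  exact ⟨B.reindex E.symm, fun j => by simp [E, hB _ (hmem j)]⟩

theorem isUnit_facetDet {Δ : SimplicialFan ι n} (hΔ : Δ.IsNonsingular) {f : Fin n → ι}
    (hf : f.Injective) (hF : Finset.univ.image f ∈ Δ.complex) : IsUnit (Δ.facetDet f) := by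
  obtain ⟨B, hB⟩ := exists_basis_of_facet hΔ hf hF
  have h := (Pi.basisFun ℤ (Fin n)).isUnit_det B
  rw [Module.Basis.det_apply] at h
  rw [facetDet, ← Matrix.det_transpose]
  have e : (Matrix.of fun j => Δ.vec (f j))ᵀ = (Pi.basisFun ℤ (Fin n)).toMatrix B := by
    ext i j
    simp [Module.Basis.toMatrix_apply, hB]
  rwa [e]

/-- The determinants of two adjacent facets are opposite. -/
theorem facetDet_update {Δ : SimplicialFan ι n} (hΔ : Δ.IsNonsingular) {f : Fin n → ι}
    (hf : f.Injective) {k : Fin n} {x : ι} (hx : ∀ j, f j ≠ x)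
    (hF : Finset.univ.image f ∈ Δ.complex)
    (hF' : Finset.univ.image (Function.update f k x) ∈ Δ.complex) :
    Δ.facetDet (Function.update f k x) = -Δ.facetDet f := by
  have hinj : (Function.update f k x).Injective := by
    intro i j hij
    by_cases hi : i = k <;> by_cases hj : j = k
    · rw [hi, hj]
    · subst hi; simp [hj] at hij; exact absurd hij.symm (hx j)
    · subst hj; simp [hi] at hij; exact absurd hij (hx i)
    · simp [hi, hj] at hij; exact hf hij
  have u1 := isUnit_facetDet hΔ hf hF
  have u2 := isUnit_facetDet hΔ hinj hF'
  set M : Matrix (Fin n) (Fin n) ℤ := Matrix.of fun j => Δ.vec (f j) with hM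
  have hd : Δ.facetDet f = M.det := rfl
  have hd' : Δ.facetDet (Function.update f k x) = (M.updateRow k (Δ.vec x)).det := by
    rw [facetDet]
    congr 1
    ext i j
    by_cases hi : i = k
    · subst hi; simp
    · simp [hi, hM]
  have hsq : M.det * M.det = 1 := by
    rw [← hd]; rcases Int.isUnit_iff.1 u1 with h | h <;> rw [h] <;> rfl
  -- Cramer's rule; as `M.det` is its own inverse, multiplying by it replaces division.
  have ht : Δ.vec x = ∑ j, (M.det * (M.updateRow j (Δ.vec x)).det) • Δ.vec (f j) := by
    have h := Matrix.mulVec_cramer Mᵀ (Δ.vec x)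
    rw [Matrix.det_transpose] at h
    have h2 : Δ.vec x = M.det • (Mᵀ *ᵥ Mᵀ.cramer (Δ.vec x)) := by
      rw [h, smul_smul, hsq, one_smul]
    rw [h2]
    ext i
    simp only [Pi.smul_apply, smul_eq_mul, Matrix.mulVec, dotProduct, Finset.mul_sum,
      Finset.sum_apply, Matrix.cramer_transpose_apply, ← h2, Matrix.transpose_apply]
    refine Finset.sum_congr rfl fun j _ => ?_
    simp only [hM, Matrix.of_apply]
    ring
  have hle := Δ.wall_coeff_nonpos hf hx hF hF' ht
  rw [← hd, ← hd'] at hle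
  rcases Int.isUnit_iff.1 u1 with h | h <;> rcases Int.isUnit_iff.1 u2 with h' | h' <;>
    simp [h, h'] at hle ⊢

end SimplicialFan
-- Cyclic matrices: determinant and adjugate
theorem cyclicMatrix_apply {m : ℕ} (a : Fin (m + 1) → ℤ) (i j : Fin (m + 1)) :
    cyclicMatrix a i j = if i = j then 1 else if i = j + 1 then a i else 0 := by
  have h : (((j : ℕ) + 1) % (m + 1) = (i : ℕ)) ↔ i = j + 1 := by
    rw [Fin.ext_iff, Fin.val_add, Fin.val_one', Nat.add_mod_mod, eq_comm]
  simp only [cyclicMatrix, Matrix.of_apply, h]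

theorem ne_add_one {m : ℕ} (i : Fin (m + 2)) : i ≠ i + 1 := by
  simp

theorem cyclicMatrix_mulVec {m : ℕ} (a c : Fin (m + 2) → ℤ) (i : Fin (m + 2)) :
    (cyclicMatrix a *ᵥ c) i = c i + a i * c (i - 1) := by
  have h : ∀ j, cyclicMatrix a i j * c j =
      (if j = i then c j else 0) + if j = i - 1 then a i * c j else 0 := by
    intro j
    rw [cyclicMatrix_apply]
    by_cases h1 : i = j
    · subst h1
      have h3 : i ≠ i - 1 := fun h => ne_add_one (i - 1) (by rw [sub_add_cancel]; exact h.symm)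
      simp [h3]
    · by_cases h2 : i = j + 1
      · subst h2; simp
      · have h3 : j ≠ i - 1 := fun h => h2 (by rw [h, sub_add_cancel])
        simp [h1, h2, h3, Ne.symm h1]
  simp only [Matrix.mulVec, dotProduct, h, Finset.sum_add_distrib, Finset.sum_ite_eq',
    Finset.mem_univ, if_true]

theorem cyclicMatrix_sum_row {m : ℕ} (a : Fin (m + 2) → ℤ) (i : Fin (m + 2)) :
    ∑ j, cyclicMatrix a i j = 1 + a i := by
  simpa [Matrix.mulVec, dotProduct] using cyclicMatrix_mulVec a (fun _ => 1) i

theorem cyclicMatrix_submatrix_addRight {m : ℕ} (a : Fin (m + 1) → ℤ) (k : Fin (m + 1)) :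
    (cyclicMatrix a).submatrix (Equiv.addRight k) (Equiv.addRight k) =
      cyclicMatrix (a ∘ Equiv.addRight k) := by
  ext i j
  have h : i + k = j + k + 1 ↔ i = j + 1 := by
    rw [add_right_comm, add_left_inj]
  simp [cyclicMatrix_apply, h]

theorem cyclic_induction {m : ℕ} {P : Fin (m + 1) → Prop} {k : Fin (m + 1)} (hk : P k)
    (h : ∀ i, P i → P (i - 1)) (i : Fin (m + 1)) : P i := by
  have key : ∀ l : ℕ, ∀ j : Fin (m + 1), (j : ℕ) = l → P (k - j) := by
    intro l
    induction l with
    | zero => intro j hj; rwa [Fin.val_eq_zero_iff.1 hj, sub_zero]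
    | succ l ih =>
      intro j hj
      have hj' : (⟨l, by omega⟩ : Fin (m + 1)) + 1 = j := by
        ext
        rw [Fin.val_add_one_of_lt (by rw [Fin.lt_def]; simp; omega), hj]
      rw [← hj', ← sub_sub]
      exact h _ (ih _ rfl)
  simpa using key _ (k - i) rfl

/-- If `i` is fixed, then `i - 1` cannot move to the occupied `i`, so it is fixed too; this
propagates around the cycle. -/
theorem perm_eq_one_or_finRotate {m : ℕ} (τ : Equiv.Perm (Fin (m + 2)))
    (h : ∀ i, τ i = i ∨ τ i = i + 1) : τ = 1 ∨ τ = finRotate (m + 2) := by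
  by_cases h1 : ∃ i, τ i = i
  · left
    obtain ⟨i₀, hi₀⟩ := h1
    refine Equiv.ext (cyclic_induction (P := fun i => τ i = i) hi₀ fun i hi => ?_)
    rcases h (i - 1) with h2 | h2
    · exact h2
    · rw [sub_add_cancel] at h2
      have := τ.injective (h2.trans hi.symm)
      exact absurd (by rw [sub_add_cancel]; exact this) (ne_add_one (i - 1))
  · right
    push Not at h1
    ext i
    rw [finRotate_apply, (h i).resolve_left (h1 i)]

/-- Only the identity and the full rotation avoid the zero entries in the Leibniz expansion. -/
theorem det_cyclicMatrix {m : ℕ} (a : Fin (m + 2) → ℤ) :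
    (cyclicMatrix a).det = 1 + (-1) ^ (m + 1) * ∏ i, a i := by
  have hne : (1 : Equiv.Perm (Fin (m + 2))) ≠ finRotate (m + 2) := by
    intro h
    have := congrArg (fun σ : Equiv.Perm (Fin (m + 2)) => σ 0) h
    simp at this
  rw [Matrix.det_apply, Fintype.sum_eq_add _ _ hne]
  · have h1 : ∏ i, cyclicMatrix a (i + 1) i = ∏ i, a i := by
      rw [← Equiv.prod_comp (Equiv.addRight (1 : Fin (m + 2))) a]
      refine Finset.prod_congr rfl fun i _ => ?_
      rw [cyclicMatrix_apply, if_neg (ne_add_one i).symm, if_pos rfl]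
      rfl
    have h0 : ∏ i, cyclicMatrix a i i = 1 :=
      Finset.prod_eq_one fun i _ => by rw [cyclicMatrix_apply, if_pos rfl]
    simp only [finRotate_apply, h1, sign_finRotate, Equiv.Perm.sign_one, one_smul,
      Equiv.Perm.coe_one, id_eq, h0]
    simp [Units.smul_def]
  · rintro τ ⟨h1, h2⟩
    obtain ⟨i, hi⟩ : ∃ i, ¬(τ i = i ∨ τ i = i + 1) := by
      by_contra! h
      rcases perm_eq_one_or_finRotate τ h with h | h
      · exact h1 h
      · exact h2 h
    push Not at hi
    rw [Finset.prod_eq_zero (Finset.mem_univ i), smul_zero]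
    rw [cyclicMatrix_apply, if_neg hi.1, if_neg hi.2]

/-- Replacing row `k` by a unit vector amounts to setting `a k = 0`, which breaks the cycle. -/
theorem adjugate_cyclicMatrix_diag {m : ℕ} (a : Fin (m + 2) → ℤ) (k : Fin (m + 2)) :
    (cyclicMatrix a).adjugate k k = 1 := by
  have h : (cyclicMatrix a).updateRow k (Pi.single k 1) =
      cyclicMatrix (Function.update a k 0) := by
    ext i j
    by_cases hi : i = k
    · subst hi
      by_cases hj : i = j
      · subst hj; simp [cyclicMatrix_apply]
      · simp [cyclicMatrix_apply, hj, Ne.symm hj]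
    · simp [cyclicMatrix_apply, hi]
  rw [Matrix.adjugate_apply, h, det_cyclicMatrix,
    Finset.prod_eq_zero (Finset.mem_univ k) (by simp), mul_zero, add_zero]

/-- Since `A * A.adjugate = 0` and each row of `A` takes a difference of cyclic neighbours, the
columns of the adjugate are constant; the diagonal fixes the constant. -/
theorem adjugate_cyclicMatrix_neg_one {m : ℕ} (i k : Fin (m + 2)) :
    (cyclicMatrix (fun _ : Fin (m + 2) => (-1 : ℤ))).adjugate i k = 1 := by
  set A := cyclicMatrix (fun _ : Fin (m + 2) => (-1 : ℤ)) with hA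
  have hdet : A.det = 0 := by
    rw [hA, det_cyclicMatrix]
    simp only [Finset.prod_const, Finset.card_univ, Fintype.card_fin]
    rw [← pow_add, Odd.neg_one_pow ⟨m + 1, by ring⟩]
    rfl
  have hstep : ∀ i, A.adjugate i k = A.adjugate (i - 1) k := by
    intro i
    have h := congrFun (congrFun (Matrix.mul_adjugate A) i) k
    rw [hdet, zero_smul] at h
    have h2 := cyclicMatrix_mulVec (fun _ : Fin (m + 2) => (-1 : ℤ)) (fun j => A.adjugate j k) i
    have h3 : (A * A.adjugate) i k = (A *ᵥ fun j => A.adjugate j k) i := rfl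
    rw [h3, h2] at h
    simp at h
    linarith
  exact cyclic_induction (P := fun i => A.adjugate i k = 1) (adjugate_cyclicMatrix_diag _ k)
    (fun i hi => (hstep i).symm.trans hi) i

/-! ### From the fan to the pair `(A, b)` -/

/-- The algebraic and geometric properties of the pair `(A, b)` of a nonsingular fan over `C_n`:
the proper principal minors of `A` are `1`, Cramer's rule for `A x = b` gives `1` in each
coordinate, and the vector of the last vertex lies in no cone spanned by other vectors. -/
structure IsAdmissible {n : ℕ} (A : Matrix (Fin n) (Fin n) ℤ) (b : Fin n → ℤ) : Prop where
  minor : ∀ {m : ℕ} (c : Fin m → Fin n), c.Injective → ¬ c.Surjective →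
    (A.submatrix c c).det = 1
  cramer : ∀ i, A.cramer b i = 1
  not_mem_cone : ∀ c : Fin n → ℤ, (∀ i, 0 ≤ c i) → (∃ i, c i = 0) →
    (∀ i, c i = 0 → b i ≤ (A *ᵥ c) i) → (∀ i, c i ≠ 0 → b i = (A *ᵥ c) i) → False

/-- The vertices of a facet of the cube: `high j` for `j ∈ I` and `low j` for `j ∉ I`. -/
def cubeFacet {n : ℕ} (I : Finset (Fin n)) (j : Fin n) : Vertex n :=
  if j ∈ I then high j else low j

theorem cubeFacet_injective {n : ℕ} (I : Finset (Fin n)) : (cubeFacet I).Injective := by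
  intro i j h
  unfold cubeFacet at h
  split_ifs at h <;> simpa using h

theorem cubeFacet_ne_cut {n : ℕ} (I : Finset (Fin n)) (j : Fin n) : cubeFacet I j ≠ cut := by
  unfold cubeFacet
  split_ifs <;> simp

theorem cubeFacet_insert {n : ℕ} (I : Finset (Fin n)) (k : Fin n) :
    cubeFacet (insert k I) = Function.update (cubeFacet I) k (high k) := by
  ext j : 1
  by_cases h : j = k
  · subst h; simp [cubeFacet]
  · simp [cubeFacet, h]

theorem low_mem_image_cubeFacet {n : ℕ} {I : Finset (Fin n)} {i : Fin n} :
    low i ∈ Finset.univ.image (cubeFacet I) ↔ i ∉ I := by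
  simp only [Finset.mem_image, Finset.mem_univ, true_and, cubeFacet]
  constructor
  · rintro ⟨j, hj⟩
    split_ifs at hj with h
    rwa [← Sum.inl_injective hj]
  · exact fun h => ⟨i, by simp [h]⟩

theorem high_mem_image_cubeFacet {n : ℕ} {I : Finset (Fin n)} {i : Fin n} :
    high i ∈ Finset.univ.image (cubeFacet I) ↔ i ∈ I := by
  simp only [Finset.mem_image, Finset.mem_univ, true_and, cubeFacet]
  constructor
  · rintro ⟨j, hj⟩
    split_ifs at hj with h
    rwa [← Sum.inl_injective (Sum.inr_injective hj)]
  · exact fun h => ⟨i, by simp [h]⟩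

theorem cut_notMem_image_cubeFacet {n : ℕ} {I : Finset (Fin n)} :
    cut ∉ Finset.univ.image (cubeFacet I) := by
  simp only [Finset.mem_image, Finset.mem_univ, true_and, not_exists]
  exact cubeFacet_ne_cut I

theorem image_cubeFacet_mem {n : ℕ} {I : Finset (Fin n)} (hI : I ≠ Finset.univ) :
    Finset.univ.image (cubeFacet I) ∈ cutCubeComplex n := by
  obtain ⟨k, hk⟩ : ∃ k, k ∉ I := by
    by_contra! h
    exact hI (Finset.eq_univ_iff_forall.2 h)
  refine ⟨⟨_, Finset.mem_image_of_mem _ (Finset.mem_univ k)⟩, fun i h => ?_, fun i h => ?_,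
    fun h => ?_⟩
  · exact (low_mem_image_cubeFacet (i := i)).1 (h (by simp))
      ((high_mem_image_cubeFacet (i := i)).1 (h (by simp)))
  · exact cut_notMem_image_cubeFacet (h (by simp))
  · exact hk (high_mem_image_cubeFacet.1 (h (Finset.mem_image_of_mem _ (Finset.mem_univ k))))

theorem image_update_cut_mem {n : ℕ} (k : Fin n) :
    Finset.univ.image (Function.update (cubeFacet (Finset.univ.erase k)) k cut) ∈
      cutCubeComplex n := by
  have hlow : ∀ i, low i ∉
      Finset.univ.image (Function.update (cubeFacet (Finset.univ.erase k)) k cut) := by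
    intro i h
    obtain ⟨j, -, hj⟩ := Finset.mem_image.1 h
    by_cases hjk : j = k
    · subst hjk; simp at hj
    · simp [hjk, cubeFacet] at hj
  refine ⟨⟨_, Finset.mem_image_of_mem _ (Finset.mem_univ k)⟩, fun i h => hlow i (h (by simp)),
    fun i h => hlow i (h (by simp)), fun h => ?_⟩
  obtain ⟨j, -, hj⟩ := Finset.mem_image.1 (h (Finset.mem_image_of_mem _ (Finset.mem_univ k)))
  by_cases hjk : j = k
  · subst hjk; simp at hj
  · simp [hjk, cubeFacet] at hj

theorem singleton_cut_mem {n : ℕ} (hn : 0 < n) : {cut} ∈ cutCubeComplex n := by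
  refine ⟨Finset.singleton_nonempty _, fun i h => ?_, fun i h => ?_, fun h => ?_⟩
  · simpa using h (Finset.mem_insert_self _ _)
  · simpa using h (Finset.mem_insert_self _ _)
  · simpa using h (Finset.mem_image_of_mem high (Finset.mem_univ ⟨0, hn⟩))

variable {n : ℕ} {Δ : SimplicialFan (Vertex n) n}

/-- Each switch from `low` to `high` crosses one wall, and all intermediate subsets stay proper. -/
theorem facetDet_cubeFacet (hΔ : Δ.IsNonsingular) (hover : Δ.complex = cutCubeComplex n)
    (I : Finset (Fin n)) (hI : I ≠ Finset.univ) :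
    Δ.facetDet (cubeFacet I) = (-1) ^ I.card * Δ.facetDet (cubeFacet ∅) := by
  induction I using Finset.induction_on with
  | empty => simp
  | insert k I hk ih =>
    have hI' : I ≠ Finset.univ := by rintro rfl; exact hk (Finset.mem_univ k)
    rw [cubeFacet_insert, SimplicialFan.facetDet_update hΔ (cubeFacet_injective I), ih hI',
      Finset.card_insert_of_notMem hk]
    · ring
    · intro j
      unfold cubeFacet
      split_ifs with h
      · rintro h'
        rw [Sum.inr.injEq, Sum.inl.injEq] at h'
        exact hk (h' ▸ h)
      · simp
    · rw [hover]; exact image_cubeFacet_mem hI'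
    · rw [← cubeFacet_insert, hover]; exact image_cubeFacet_mem hI

theorem facetDet_update_cut (hΔ : Δ.IsNonsingular) (hover : Δ.complex = cutCubeComplex n)
    (k : Fin n) :
    Δ.facetDet (Function.update (cubeFacet (Finset.univ.erase k)) k cut) =
      (-1) ^ n * Δ.facetDet (cubeFacet ∅) := by
  have hI : Finset.univ.erase k ≠ Finset.univ := by
    intro h
    have := Finset.mem_univ k
    rw [← h] at this
    simp at this
  rw [SimplicialFan.facetDet_update hΔ (cubeFacet_injective _) (cubeFacet_ne_cut _)
    (by rw [hover]; exact image_cubeFacet_mem hI) (by rw [hover]; exact image_update_cut_mem k),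
    facetDet_cubeFacet hΔ hover _ hI, Finset.card_erase_of_mem (Finset.mem_univ k),
    Finset.card_univ, Fintype.card_fin]
  obtain ⟨m, rfl⟩ : ∃ m, n = m + 1 := ⟨n - 1, by have := k.pos; omega⟩
  rw [Nat.add_sub_cancel]
  ring

theorem facetDet_eq_det_mul {g : Fin n → Vertex n} {N : Matrix (Fin n) (Fin n) ℤ}
    (h : ∀ j, Δ.vec (g j) = ∑ i, N j i • Δ.vec (low i)) :
    Δ.facetDet g = N.det * Δ.facetDet (cubeFacet ∅) := by
  rw [SimplicialFan.facetDet, SimplicialFan.facetDet, ← Matrix.det_mul]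
  congr 1
  ext j k
  simp [h, Matrix.mul_apply, cubeFacet, Finset.sum_apply]

theorem facetDet_low_ne_zero (hn : 0 < n) (hΔ : Δ.IsNonsingular)
    (hover : Δ.complex = cutCubeComplex n) : Δ.facetDet (cubeFacet ∅) ≠ 0 :=
  (SimplicialFan.isUnit_facetDet hΔ (cubeFacet_injective ∅) (by
    rw [hover]
    refine image_cubeFacet_mem fun h => ?_
    have := Finset.mem_univ (⟨0, hn⟩ : Fin n)
    rw [← h] at this
    simp at this)).ne_zero

variable {A : Matrix (Fin n) (Fin n) ℤ} {b : Fin n → ℤ}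

theorem principal_minor_eq_one (hΔ : Δ.IsNonsingular) (hover : Δ.complex = cutCubeComplex n)
    (hA : IsAssociated Δ.vec A b) {m : ℕ} (c : Fin m → Fin n) (hc : c.Injective)
    (hs : ¬ c.Surjective) : (A.submatrix c c).det = 1 := by
  have hn : 0 < n := by
    rw [Nat.pos_iff_ne_zero]
    rintro rfl
    exact hs fun x => x.elim0
  set I : Finset (Fin n) := Finset.univ.image c with hIdef
  have hmem : ∀ i, c i ∈ I := fun i => Finset.mem_image_of_mem c (Finset.mem_univ i)
  have hI : I ≠ Finset.univ := by
    intro h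
    refine hs fun y => ?_
    have := Finset.mem_univ y
    rw [← h] at this
    simpa [hIdef] using this
  have hcard : I.card = m := by
    rw [hIdef, Finset.card_image_of_injective _ hc, Finset.card_univ, Fintype.card_fin]
  -- Row `j` holds the `low` coordinates of the `j`-th facet vector. Rows outside `I` are unit
  -- vectors, so only the block `-A` on `I`, transposed, contributes to the determinant.
  let N : Matrix (Fin n) (Fin n) ℤ :=
    Matrix.of fun j i => if j ∈ I then -A i j else if i = j then 1 else 0
  have h1 := facetDet_cubeFacet hΔ hover I hI
  rw [facetDet_eq_det_mul (N := N) (fun j => by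
    by_cases h : j ∈ I
    · simp [N, cubeFacet, h, hA.1]
    · simp [N, cubeFacet, h])] at h1
  have h2 := mul_right_cancel₀ (facetDet_low_ne_zero hn hΔ hover) h1
  have h3 := Matrix.twoBlockTriangular_det N (fun j => j ∈ I) (fun i hi j hj => by
    simp only [N, Matrix.of_apply, if_neg hi]
    rw [if_neg]
    rintro rfl
    exact hi hj)
  have h4 : N.toSquareBlockProp (fun j => ¬ j ∈ I) = 1 := by
    ext i j
    simp [N, Matrix.toSquareBlockProp, i.2, Matrix.one_apply, Subtype.ext_iff, eq_comm]
  let e : Fin m ≃ {j // j ∈ I} := Equiv.ofBijective (fun x => ⟨c x, hmem x⟩)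
    ⟨fun x y h => hc (congrArg Subtype.val h), fun ⟨y, hy⟩ => by
      obtain ⟨x, -, hx⟩ := Finset.mem_image.1 hy
      exact ⟨x, Subtype.ext hx⟩⟩
  have h5 : (N.toSquareBlockProp (fun j => j ∈ I)).submatrix e e = (-(A.submatrix c c))ᵀ := by
    ext i j
    simp [N, Matrix.toSquareBlockProp, e]
    rfl
  rw [h4, Matrix.det_one, mul_one, h2, hcard] at h3
  have h7 := Matrix.det_submatrix_equiv_self e (N.toSquareBlockProp (fun j => j ∈ I))
  rw [h5, Matrix.det_transpose, Matrix.det_neg, Fintype.card_fin] at h7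
  have h8 : (-1 : ℤ) ^ m = (-1) ^ m * (A.submatrix c c).det := h3.trans (by convert h7.symm)
  have h6 : ((-1 : ℤ) ^ m) ≠ 0 := pow_ne_zero _ (by norm_num)
  exact (mul_left_cancel₀ h6 (by rw [mul_one]; exact h8)).symm

theorem cramer_eq_one (hΔ : Δ.IsNonsingular) (hover : Δ.complex = cutCubeComplex n)
    (hA : IsAssociated Δ.vec A b) (k : Fin n) : A.cramer b k = 1 := by
  have h1 := facetDet_update_cut hΔ hover k
  rw [facetDet_eq_det_mul (N := -(Aᵀ.updateRow k b)) (fun j => by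
    by_cases h : j = k
    · subst h; simp [hA.2]
    · simp [cubeFacet, h, hA.1])] at h1
  have h2 := mul_right_cancel₀ (facetDet_low_ne_zero k.pos hΔ hover) h1
  rw [Matrix.det_neg, Fintype.card_fin] at h2
  have h3 : ((-1 : ℤ) ^ n) ≠ 0 := pow_ne_zero _ (by norm_num)
  have h4 := mul_left_cancel₀ h3 (h2.trans (mul_one _).symm)
  rw [← h4, ← Matrix.cramer_transpose_apply, Matrix.transpose_transpose]

/-- The `c j` serve as coefficients on `high j`, and the slacks `(A *ᵥ c) j - b j` on `low j` where
`c j = 0`. They would put the vector of `cut` in the cone of a facet that meets `cone {cut}` only in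
`0`. -/
theorem vec_cut_not_mem_cone (hover : Δ.complex = cutCubeComplex n)
    (hA : IsAssociated Δ.vec A b) (c : Fin n → ℤ) (h0 : ∀ i, 0 ≤ c i) (hex : ∃ i, c i = 0)
    (hle : ∀ i, c i = 0 → b i ≤ (A *ᵥ c) i) (heq : ∀ i, c i ≠ 0 → b i = (A *ᵥ c) i) :
    False := by
  obtain ⟨i₀, hi₀⟩ := hex
  set I : Finset (Fin n) := Finset.univ.filter fun j => c j ≠ 0 with hIdef
  have hI : I ≠ Finset.univ := by
    intro h
    have := Finset.mem_univ i₀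
    rw [← h] at this
    simp [hIdef, hi₀] at this
  let γ : Fin n → ℤ := fun j => if c j = 0 then (A *ᵥ c) j - b j else c j
  have hhigh : ∑ j, c j • Δ.vec (high j) = -∑ i, (A *ᵥ c) i • Δ.vec (low i) := by
    simp only [hA.1, smul_neg, Finset.sum_neg_distrib, Finset.smul_sum, Matrix.mulVec, dotProduct,
      Finset.sum_smul]
    rw [Finset.sum_comm]
    simp only [smul_smul, mul_comm]
  have hcut : Δ.vec cut = ∑ j, γ j • Δ.vec (cubeFacet I j) := by
    have h1 : ∀ j, γ j • Δ.vec (cubeFacet I j) =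
        ((A *ᵥ c) j - b j) • Δ.vec (low j) + c j • Δ.vec (high j) := by
      intro j
      by_cases h : c j = 0
      · simp [γ, cubeFacet, hIdef, h]
      · simp [γ, cubeFacet, hIdef, h, heq j h]
    simp only [h1, Finset.sum_add_distrib, hhigh, sub_smul, Finset.sum_sub_distrib, hA.2]
    abel
  have m1 := mem_cone_image Δ.vec (cubeFacet_injective I) (γ := γ) (fun j => by
    by_cases h : c j = 0
    · simp [γ, h, hle j h]
    · simp [γ, h, h0 j]) hcut
  have hF : Finset.univ.image (cubeFacet I) ∈ Δ.complex := by
    rw [hover]; exact image_cubeFacet_mem hI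
  have hC : {cut} ∈ Δ.complex := by
    rw [hover]; exact singleton_cut_mem i₀.pos
  have m2 : (fun k => (Δ.vec cut k : ℝ)) ∈ cone Δ.vec {cut} :=
    ⟨fun _ => 1, fun _ _ => zero_le_one, by simp⟩
  have m3 : (fun k => (Δ.vec cut k : ℝ)) ∈ cone Δ.vec (Finset.univ.image (cubeFacet I) ∩ {cut}) :=
    Δ.cone_inter _ hF _ hC ▸ ⟨m1, m2⟩
  rw [Finset.inter_singleton_of_notMem cut_notMem_image_cubeFacet] at m3
  obtain ⟨α, -, hα⟩ := m3
  rw [Finset.sum_empty] at hα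
  have := Δ.coeff_eq hC (α := fun _ => 1) (β := fun _ => 0) (by simp [hα])
    (Finset.mem_singleton_self _)
  norm_num at this

theorem IsAssociated.isAdmissible (hΔ : Δ.IsNonsingular) (hover : Δ.complex = cutCubeComplex n)
    (hA : IsAssociated Δ.vec A b) : IsAdmissible A b :=
  ⟨principal_minor_eq_one hΔ hover hA, cramer_eq_one hΔ hover hA, vec_cut_not_mem_cone hover hA⟩

theorem existsUnique_isAssociated (hn : 0 < n) (hΔ : Δ.IsNonsingular)
    (hover : Δ.complex = cutCubeComplex n) :
    ∃! p : Matrix (Fin n) (Fin n) ℤ × (Fin n → ℤ), IsAssociated Δ.vec p.1 p.2 := by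
  obtain ⟨B, hB⟩ := SimplicialFan.exists_basis_of_facet hΔ (cubeFacet_injective ∅) (by
    rw [hover]
    refine image_cubeFacet_mem fun h => ?_
    have := Finset.mem_univ (⟨0, hn⟩ : Fin n)
    rw [← h] at this
    simp at this)
  have hB' : ∀ j, Δ.vec (low j) = B j := fun j => by rw [hB]; simp [cubeFacet]
  have key : ∀ (x y : Fin n → ℤ), x = -∑ i, y i • Δ.vec (low i) ↔ y = fun i => -B.repr x i := by
    intro x y
    simp only [hB', ← Module.Basis.equivFun_symm_apply]
    rw [eq_neg_iff_add_eq_zero, ← neg_eq_iff_add_eq_zero, eq_comm, ← LinearEquiv.eq_symm_apply]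
    simp only [LinearEquiv.symm_symm, map_neg]
    rfl
  refine ⟨(Matrix.of fun i j => -B.repr (Δ.vec (high j)) i, fun i => -B.repr (Δ.vec cut) i),
    ⟨fun j => (key _ _).2 rfl, (key _ _).2 rfl⟩, ?_⟩
  rintro ⟨A, b⟩ ⟨h1, h2⟩
  refine Prod.ext ?_ ((key _ _).1 h2)
  ext i j
  exact congrFun ((key _ (fun i => A i j)).1 (h1 j)) i

/-! ### Matrices with proper principal minors equal to 1 -/

/-- A relation on a finite type that is not well-founded has a closed walk without chords. -/
theorem exists_chordless_cycle {α : Type*} [Finite α] {r : α → α → Prop} (hr : ¬ WellFounded r) :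
    ∃ (m : ℕ) (c : Fin (m + 1) → α), ∀ i j, r (c i) (c j) ↔ j = i + 1 := by
  classical
  have hex : ∃ (m : ℕ) (c : Fin (m + 1) → α), ∀ i, r (c i) (c (i + 1)) := by
    rw [wellFounded_iff_isEmpty_descending_chain, not_isEmpty_iff] at hr
    obtain ⟨f, hf⟩ := hr
    obtain ⟨i, j, hij, hfij⟩ : ∃ i j, i < j ∧ f i = f j := by
      obtain ⟨i, j, hne, h⟩ := Finite.exists_ne_map_eq_of_infinite f
      rcases lt_or_gt_of_ne hne with h1 | h1
      · exact ⟨i, j, h1, h⟩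
      · exact ⟨j, i, h1, h.symm⟩
    obtain ⟨m, rfl⟩ : ∃ m, j = i + m + 1 := ⟨j - i - 1, by omega⟩
    -- The chain descends, so it is read backwards to follow `r`.
    refine ⟨m, fun t => f (i + m + 1 - t), fun t => ?_⟩
    by_cases ht : t = Fin.last m
    · subst ht
      have h := hf i
      rw [hfij] at h
      simpa [show i + m + 1 - m = i + 1 by omega] using h
    · have hlt := Fin.lt_last_iff_ne_last.2 ht
      have hlt' : (t : ℕ) < m := hlt
      simp only [Fin.val_add_one_of_lt hlt]
      have h := hf (i + m + 1 - (t + 1))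
      rwa [show i + m + 1 - ((t : ℕ) + 1) + 1 = i + m + 1 - t by omega] at h
  obtain ⟨m, ⟨c, hc⟩, hmin⟩ : ∃ m, (∃ c : Fin (m + 1) → α, ∀ i, r (c i) (c (i + 1))) ∧
      ∀ l < m, ¬ ∃ c : Fin (l + 1) → α, ∀ i, r (c i) (c (i + 1)) :=
    ⟨Nat.find hex, Nat.find_spec hex, fun l hl => Nat.find_min hex hl⟩
  refine ⟨m, c, fun i j => ⟨fun h => ?_, by rintro rfl; exact hc i⟩⟩
  by_contra hj
  -- The chord from `i` to `j` closes the walk `j, j + 1, …, i`, which is shorter than the minimal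
  -- one.
  have hL : ((i - j : Fin (m + 1)) : ℕ) < m := by
    refine lt_of_le_of_ne (Nat.lt_succ_iff.1 (i - j).2) fun h' => hj ?_
    have h1 : i - j = Fin.last m := Fin.ext h'
    have h2 : i - j + 1 = 0 := by rw [h1, Fin.last_add_one]
    rw [sub_add_eq_add_sub, sub_eq_zero] at h2
    exact h2.symm
  refine hmin _ hL
    ⟨fun t => c (j + ⟨(t : ℕ), lt_of_le_of_lt (Nat.lt_succ_iff.1 t.2) (i - j).2⟩), fun t => ?_⟩
  by_cases ht : t = Fin.last _
  · subst ht
    simpa using h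
  · have hlt := Fin.lt_last_iff_ne_last.2 ht
    have hlt' : (t : ℕ) < ((i - j : Fin (m + 1)) : ℕ) := hlt
    simp only [Fin.val_add_one_of_lt hlt]
    have htm : (t : ℕ) < m + 1 := by omega
    have e : (⟨(t : ℕ), htm⟩ + 1 : Fin (m + 1)) = ⟨(t : ℕ) + 1, by omega⟩ :=
      Fin.ext (Fin.val_add_one_of_lt (by rw [Fin.lt_def]; simp only [Fin.val_last]; omega))
    have h := hc (j + ⟨(t : ℕ), htm⟩)
    rwa [add_assoc, e] at h

/-- An integer matrix whose proper principal minors are all `1` is, up to a simultaneous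
permutation of rows and columns, lower triangular or cyclic. -/
theorem exists_perm_lowerTriangular_or_cyclic {k : ℕ} {A : Matrix (Fin (k + 2)) (Fin (k + 2)) ℤ}
    (hA : ∀ {m : ℕ} (c : Fin m → Fin (k + 2)), c.Injective → ¬ c.Surjective →
      (A.submatrix c c).det = 1) :
    ∃ σ : Equiv.Perm (Fin (k + 2)), (∀ i j, i < j → A (σ i) (σ j) = 0) ∨
      ∃ a : Fin (k + 2) → ℤ, (∀ i, a i ≠ 0) ∧ A.submatrix σ σ = cyclicMatrix a := by
  have hdiag : ∀ i, A i i = 1 := by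
    intro i
    have h := hA (fun _ : Fin 1 => i) (Function.injective_of_subsingleton _) (fun hs => by
      obtain ⟨_, h⟩ := hs (i + 1)
      exact ne_add_one i h)
    simpa using h
  let r : Fin (k + 2) → Fin (k + 2) → Prop := fun x y => x ≠ y ∧ A y x ≠ 0
  by_cases hr : WellFounded r
  · have : IsWellFounded _ r := ⟨hr⟩
    -- A nonzero off-diagonal `A y x` forces `x` to have smaller rank than `y`, so sorting by rank
    -- puts it below the diagonal.
    refine ⟨Tuple.sort (IsWellFounded.rank r), Or.inl fun i j hij => ?_⟩
    by_contra h
    have h1 := Tuple.monotone_sort (IsWellFounded.rank r) hij.le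
    refine not_lt_of_ge h1 (IsWellFounded.rank_lt_of_rel ⟨?_, h⟩)
    exact fun h => hij.ne' (Equiv.injective _ h)
  · obtain ⟨m, c, hc⟩ := exists_chordless_cycle hr
    have hinj : c.Injective := by
      intro i j hij
      have h := (hc (i - 1) i).2 (by rw [sub_add_cancel])
      rw [hij, hc, sub_add_cancel] at h
      exact h.symm
    obtain _ | m := m
    -- A cycle of length one would be a loop, excluded by `x ≠ y` in `r`.
    · exact absurd rfl ((hc 0 0).2 (by decide)).1
    let a : Fin (m + 2) → ℤ := fun i => A (c i) (c (i - 1))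
    have ha : ∀ i, a i ≠ 0 := fun i => ((hc (i - 1) i).2 (by rw [sub_add_cancel])).2
    have hcyc : A.submatrix c c = cyclicMatrix a := by
      ext i j
      rw [cyclicMatrix_apply, Matrix.submatrix_apply]
      split_ifs with h1 h2
      · rw [h1, hdiag]
      · simp [a, h2]
      · by_contra h
        exact h2 ((hc j i).1 ⟨fun h' => h1 (hinj h').symm, h⟩)
    have hsurj : c.Surjective := by
      by_contra hs
      have h := hA c hinj hs
      rw [hcyc, det_cyclicMatrix, add_eq_left] at h
      exact mul_ne_zero (pow_ne_zero _ (by norm_num)) (Finset.prod_ne_zero_iff.2 fun i _ => ha i) h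
    obtain rfl : m = k := by
      have := Fintype.card_of_bijective (f := c) ⟨hinj, hsurj⟩
      simpa using this
    exact ⟨Equiv.ofBijective c ⟨hinj, hsurj⟩, Or.inr ⟨a, ha, hcyc⟩⟩

/-! ### Classification of admissible pairs -/

theorem IsAdmissible.submatrix {n : ℕ} {A : Matrix (Fin n) (Fin n) ℤ} {b : Fin n → ℤ}
    (h : IsAdmissible A b) (σ : Equiv.Perm (Fin n)) :
    IsAdmissible (A.submatrix σ σ) (b ∘ σ) := by
  refine ⟨fun c hc hs => ?_, fun i => ?_, fun c h0 hex hle heq => ?_⟩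
  · rw [Matrix.submatrix_submatrix]
    refine h.minor (σ ∘ c) (σ.injective.comp hc) fun hs' => hs fun y => ?_
    obtain ⟨x, hx⟩ := hs' (σ y)
    exact ⟨x, σ.injective hx⟩
  · rw [Matrix.cramer_submatrix_equiv]
    simp [Function.comp_assoc, h.cramer]
  · have hm : ∀ i, (A.submatrix σ σ *ᵥ c) (σ.symm i) = (A *ᵥ (c ∘ σ.symm)) i := by
      intro i
      rw [Matrix.submatrix_mulVec_equiv]
      simp
    refine h.not_mem_cone (c ∘ σ.symm) (fun i => h0 _) ?_ (fun i hi => ?_) (fun i hi => ?_)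
    · obtain ⟨i, hi⟩ := hex
      exact ⟨σ i, by simpa using hi⟩
    · rw [← hm]; simpa using hle (σ.symm i) hi
    · rw [← hm]; simpa using heq (σ.symm i) hi

theorem IsAdmissible.sum_row {n : ℕ} {A : Matrix (Fin n) (Fin n) ℤ} {b : Fin n → ℤ}
    (h : IsAdmissible A b) (i : Fin n) : ∑ j, A i j = A.det * b i := by
  have h1 := congrFun (Matrix.mulVec_cramer A b) i
  simpa [Matrix.mulVec, dotProduct, h.cramer] using h1

theorem IsAdmissible.isColumnSumDiv {n : ℕ} {A : Matrix (Fin n) (Fin n) ℤ} {b : Fin n → ℤ}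
    (h : IsAdmissible A b) (hA : A.det ≠ 0) : IsColumnSumDiv A b A.det := by
  intro i
  have h1 : ((∑ j, A i j : ℤ) : ℚ) = A.det * b i := by exact_mod_cast h.sum_row i
  have h2 : (A.det : ℚ) ≠ 0 := by exact_mod_cast hA
  rw [Int.cast_sum] at h1
  rw [h1]
  field_simp

theorem IsAdmissible.isTypeOne {k : ℕ} {A : Matrix (Fin (k + 2)) (Fin (k + 2)) ℤ}
    {b : Fin (k + 2) → ℤ} (h : IsAdmissible A b) (hA : ∀ i j, i < j → A i j = 0) :
    IsTypeOne A b := by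
  have hdiag : ∀ i, A i i = 1 := by
    intro i
    have h := h.minor (fun _ : Fin 1 => i) (Function.injective_of_subsingleton _) (fun hs => by
      obtain ⟨_, h⟩ := hs (i + 1)
      exact ne_add_one i h)
    simpa using h
  have hdet : A.det = 1 := by
    rw [Matrix.det_of_isLowerTriangular A (fun i j hij => hA i j hij)]
    exact Finset.prod_eq_one fun i _ => hdiag i
  exact ⟨hdet, hdiag, hA, fun i => by rw [h.sum_row, hdet, one_mul]⟩

/-- Some factor has absolute value at least `|1 - q|`, and no factor vanishes, so that factor
attains it and the others are units. For negative `q`, a positive `b i` is needed to find such a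
factor. -/
theorem exists_eq_one_of_prod {ι : Type*} [Fintype ι] {b : ι → ℤ} {q : ℤ}
    (h0 : q ≠ 0) (h1 : q ≠ 1) (h2 : q ≠ 2) (hprod : ∏ i, (1 - q * b i) = 1 - q)
    (hneg : q < 0 → ∃ i, 0 < b i) :
    ∃ i, b i = 1 ∧ ∀ j, j ≠ i → b j ≤ 0 ∧ (b j = 0 ∨ q * b j = 2) := by
  classical
  have hq3 : q < 0 ∨ 3 ≤ q := by omega
  have hne : 1 - q ≠ 0 := fun h => h1 (by linarith)
  obtain ⟨i, hi⟩ : ∃ i, |1 - q| ≤ |1 - q * b i| ∧ (q < 0 → 0 < b i) := by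
    rcases hq3 with hq | hq
    · obtain ⟨i, hi⟩ := hneg hq
      refine ⟨i, ?_, fun _ => hi⟩
      rw [abs_of_pos (by linarith), abs_of_pos (by nlinarith)]
      nlinarith
    · obtain ⟨i, hi⟩ : ∃ i, b i ≠ 0 := by
        by_contra! h
        simp [h] at hprod
        linarith
      refine ⟨i, ?_, fun h => absurd h (by linarith)⟩
      rw [abs_of_neg (by linarith)]
      rcases lt_or_gt_of_ne hi with hb | hb
      · refine le_trans ?_ (le_abs_self _)
        nlinarith
      · refine le_trans ?_ (neg_le_abs _)
        nlinarith
  obtain ⟨hi, hpos⟩ := hi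
  rw [← Finset.mul_prod_erase _ _ (Finset.mem_univ i)] at hprod
  set R := ∏ j ∈ Finset.univ.erase i, (1 - q * b j) with hR
  have hRne : R ≠ 0 := by
    intro h
    rw [h, mul_zero] at hprod
    exact hne hprod.symm
  have habs : |1 - q * b i| * |R| = |1 - q| := by rw [← abs_mul, hprod]
  have hRpos : 1 ≤ |R| := Int.one_le_abs hRne
  have hqpos : 1 ≤ |1 - q| := Int.one_le_abs hne
  have hR1 : |R| = 1 := by nlinarith
  rw [hR1, mul_one] at habs
  have hbi : b i = 1 := by
    rcases abs_eq_abs.1 habs with h | h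
    · exact mul_left_cancel₀ h0 (by linarith)
    · exfalso
      rcases hq3 with hq | hq
      · have := hpos hq
        nlinarith
      · have hd : q ∣ 2 := ⟨b i + 1, by linarith⟩
        have := Int.le_of_dvd (by norm_num) hd
        linarith
  refine ⟨i, hbi, fun j hj => ?_⟩
  have hu : IsUnit (1 - q * b j) := by
    have hdvd : (1 - q * b j) ∣ R :=
      Finset.dvd_prod_of_mem (fun j => 1 - q * b j) (Finset.mem_erase.2 ⟨hj, Finset.mem_univ j⟩)
    exact isUnit_of_dvd_unit hdvd (Int.isUnit_iff_abs_eq.2 hR1)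
  rcases Int.isUnit_iff.1 hu with h | h
  · have hb : b j = 0 := by
      have : q * b j = 0 := by linarith
      exact (mul_eq_zero.1 this).resolve_left h0
    exact ⟨hb.le, Or.inl hb⟩
  · have hb : q * b j = 2 := by linarith
    refine ⟨?_, Or.inr hb⟩
    rcases hq3 with hq | hq
    · nlinarith
    · have := Int.le_of_dvd (by norm_num) (⟨b j, hb.symm⟩ : q ∣ 2)
      linarith

variable {k : ℕ} {a b : Fin (k + 2) → ℤ}

theorem IsAdmissible.add_one_eq (h : IsAdmissible (cyclicMatrix a) b) (i : Fin (k + 2)) :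
    1 + a i = (cyclicMatrix a).det * b i := by
  rw [← h.sum_row, cyclicMatrix_sum_row]

/-- The row sums determine `a` but not `b`; a Cramer numerator with the all-ones adjugate supplies
`∑ b i = 1`. -/
theorem IsAdmissible.isTypeZero (h : IsAdmissible (cyclicMatrix a) b)
    (hdet : (cyclicMatrix a).det = 0) : IsTypeZero (cyclicMatrix a) b := by
  have ha : a = fun _ => -1 := by
    ext i
    have := h.add_one_eq i
    rw [hdet, zero_mul] at this
    linarith
  refine ⟨hdet, by rw [ha], ?_⟩
  have h1 := h.cramer 0
  rw [ha, Matrix.cramer_eq_adjugate_mulVec] at h1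
  simpa [Matrix.mulVec, dotProduct, adjugate_cyclicMatrix_neg_one] using h1

theorem IsAdmissible.isTypeTwo (h : IsAdmissible (cyclicMatrix a) b)
    (hdet : (cyclicMatrix a).det = 2) : IsTypeTwo (cyclicMatrix a) b := by
  have hcol := h.isColumnSumDiv (by rw [hdet]; norm_num)
  have h1 := det_cyclicMatrix a
  rw [hdet] at h1
  have hprod : (-1) ^ (k + 1) * ∏ i, a i = 1 := by linarith
  have ha : ∀ i, a i = 1 ∨ a i = -1 := fun i => Int.isUnit_iff.1
    (isUnit_of_dvd_one ((Finset.dvd_prod_of_mem a (Finset.mem_univ i)).trans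
      (Dvd.intro_left _ hprod)))
  refine ⟨hdet, a, ha, ?_, rfl, by simpa [hdet] using hcol⟩
  have h2 : ∏ i, a i = (-1) ^ (k + 2) * (-1) ^ (Finset.univ.filter fun i => a i = 1).card := by
    -- Pulling out a sign from every entry leaves one `-1` for each `a i = 1`, so the product
    -- detects the parity of their number.
    have h3 : ∀ i, a i = -1 * if a i = 1 then -1 else 1 := by
      intro i
      rcases ha i with h | h <;> simp [h]
    rw [Finset.prod_congr rfl fun i _ => h3 i, Finset.prod_mul_distrib, Finset.prod_ite]
    simp
  rw [h2, ← mul_assoc, ← pow_add, Odd.neg_one_pow (n := k + 1 + (k + 2)) ⟨k + 1, by ring⟩] at hprod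
  rw [neg_one_mul, neg_eq_iff_eq_neg] at hprod
  by_contra hodd
  rw [(Nat.not_odd_iff_even.1 hodd).neg_one_pow] at hprod
  norm_num at hprod

theorem IsAdmissible.exists_eq_one (h : IsAdmissible (cyclicMatrix a) b)
    (h0 : (cyclicMatrix a).det ≠ 0) (h1 : (cyclicMatrix a).det ≠ 1)
    (h2 : (cyclicMatrix a).det ≠ 2) :
    ∃ i, b i = 1 ∧ ∀ j, j ≠ i → b j ≤ 0 ∧ (b j = 0 ∧ a j = -1 ∨ a j = 1) := by
  set q := (cyclicMatrix a).det with hq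
  have hdet := det_cyclicMatrix a
  have ha : ∀ i, a i = -1 * (1 - q * b i) := fun i => by linarith [h.add_one_eq i]
  rw [Finset.prod_congr rfl fun i _ => ha i, Finset.prod_mul_distrib, ← mul_assoc,
    Finset.prod_const, Finset.card_univ, Fintype.card_fin, ← pow_add,
    Odd.neg_one_pow (n := k + 1 + (k + 2)) ⟨k + 1, by ring⟩, ← hq] at hdet
  obtain ⟨i, hi, hj⟩ := exists_eq_one_of_prod h0 h1 h2 (by linarith) (fun _ => by
    by_contra! hb
    -- If no `b i` were positive, the vector of `cut` would lie in the all-`low` cone.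
    exact h.not_mem_cone 0 (fun _ => le_rfl) ⟨0, rfl⟩ (fun i _ => by simpa using hb i)
      (fun i hi => absurd rfl hi))
  refine ⟨i, hi, fun j hne => ⟨(hj j hne).1, ?_⟩⟩
  rcases (hj j hne).2 with hb | hb
  · exact Or.inl ⟨hb, by rw [ha, hb]; ring⟩
  · exact Or.inr (by rw [ha, hb]; norm_num)

/-- Let `l` be the first nonzero index with `a l = 1`, and `c` the indicator of the indices below
`l`. The entries `-1` before `l` telescope, so `A *ᵥ c` is `1` at `0` and at `l` and zero elsewhere;
this agrees with `b` below `l` and dominates it from `l` on, against `not_mem_cone`. -/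
theorem IsAdmissible.ne_one (h : IsAdmissible (cyclicMatrix a) b) (hb0 : b 0 = 1)
    (hb : ∀ j, j ≠ 0 → b j ≤ 0 ∧ (b j = 0 ∧ a j = -1 ∨ a j = 1)) (j : Fin (k + 2)) (hj : j ≠ 0) :
    a j ≠ 1 := by
  intro haj
  obtain ⟨l, ⟨hl0, hl⟩, hmin⟩ := WellFounded.has_min (wellFounded_lt (α := Fin (k + 2)))
    {j | j ≠ 0 ∧ a j = 1} ⟨j, hj, haj⟩
  have hlpos : 0 < l := Fin.pos_iff_ne_zero.2 hl0
  let c : Fin (k + 2) → ℤ := fun i => if i < l then 1 else 0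
  have hprev : ∀ i : Fin (k + 2), i ≠ 0 → ((i - 1 : Fin (k + 2)) : ℕ) = i - 1 := fun i hi => by
    rw [Fin.val_sub_one_of_ne_zero hi]
  have hmul : ∀ i, (cyclicMatrix a *ᵥ c) i = c i + a i * c (i - 1) := cyclicMatrix_mulVec a c
  have hc1 : ∀ i, i < l → c i = 1 := fun i hi => if_pos hi
  have hc0 : ∀ i, ¬ i < l → c i = 0 := fun i hi => if_neg hi
  refine h.not_mem_cone c (fun i => ?_) ⟨l, hc0 l (lt_irrefl l)⟩ (fun i hi => ?_) (fun i hi => ?_)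
  · by_cases hi : i < l
    · rw [hc1 i hi]; exact zero_le_one
    · rw [hc0 i hi]
  · have hil : ¬ i < l := fun h => by rw [hc1 i h] at hi; norm_num at hi
    have hi0 : i ≠ 0 := fun h => hil (h ▸ hlpos)
    rw [hmul, hi, zero_add]
    by_cases hil' : i = l
    · subst hil'
      rw [hc1 (i - 1) (by rw [Fin.lt_def, hprev i hi0]; have := Fin.val_ne_zero_iff.2 hi0; omega),
        hl]
      linarith [(hb i hi0).1]
    · rw [hc0 (i - 1) (by
        rw [Fin.lt_def, hprev i hi0]
        have : (i : ℕ) ≠ l := fun h => hil' (Fin.ext h)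
        rw [Fin.lt_def] at hil
        omega), mul_zero]
      exact (hb i hi0).1
  · have hil : i < l := by
      by_contra h
      exact hi (hc0 i h)
    rw [hmul, hc1 i hil]
    by_cases hi0 : i = 0
    · subst hi0
      rw [hc0 (0 - 1) (by
        rw [zero_sub, Fin.lt_def, Fin.coe_neg_one]
        omega), hb0]
      ring
    · have hai : a i ≠ 1 := fun h => hmin i ⟨hi0, h⟩ hil
      obtain ⟨h1, h2⟩ := (hb i hi0).2.resolve_right hai
      rw [hc1 (i - 1) (by rw [Fin.lt_def, hprev i hi0]; rw [Fin.lt_def] at hil; omega), h1, h2]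
      norm_num

theorem IsAdmissible.isTypeThree (h : IsAdmissible (cyclicMatrix a) b) (hb0 : b 0 = 1)
    (hb : ∀ j, j ≠ 0 → b j ≤ 0 ∧ (b j = 0 ∧ a j = -1 ∨ a j = 1))
    (h0 : (cyclicMatrix a).det ≠ 0) (h1 : (cyclicMatrix a).det ≠ 1)
    (h2 : (cyclicMatrix a).det ≠ 2) : IsTypeThree (cyclicMatrix a) b := by
  have hj : ∀ j, j ≠ 0 → b j = 0 ∧ a j = -1 := fun j hj =>
    (hb j hj).2.resolve_right (h.ne_one hb0 hb j hj)
  have hdet := h.add_one_eq 0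
  rw [hb0, mul_one] at hdet
  refine ⟨⟨h0, h1, h2⟩, ⟨a 0, ?_, ?_, ?_, ?_⟩, h.isColumnSumDiv h0, fun i => ?_⟩
  · intro h; exact h1 (by rw [← hdet, h]; rfl)
  · intro h; exact h2 (by rw [← hdet, h]; rfl)
  · intro h; exact h0 (by rw [← hdet, h]; rfl)
  · congr 1
    ext i
    by_cases hi : i = 0
    · simp [hi]
    · rw [if_neg (Fin.val_ne_zero_iff.2 hi), (hj i hi).2]
  · by_cases hi : i = 0
    · simp [hi, hb0]
    · rw [if_neg (Fin.val_ne_zero_iff.2 hi), (hj i hi).1]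

theorem IsAdmissible.exists_type {A : Matrix (Fin (k + 2)) (Fin (k + 2)) ℤ}
    (h : IsAdmissible A b) :
    ∃ σ : Equiv.Perm (Fin (k + 2)),
      IsTypeZero (A.submatrix σ σ) (b ∘ σ) ∨ IsTypeOne (A.submatrix σ σ) (b ∘ σ) ∨
      IsTypeTwo (A.submatrix σ σ) (b ∘ σ) ∨ IsTypeThree (A.submatrix σ σ) (b ∘ σ) := by
  obtain ⟨σ, hσ | ⟨a, ha, hσ⟩⟩ := exists_perm_lowerTriangular_or_cyclic h.minor
  · exact ⟨σ, Or.inr (Or.inl ((h.submatrix σ).isTypeOne hσ))⟩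
  have h' := h.submatrix σ
  rw [hσ] at h'
  by_cases h0 : (cyclicMatrix a).det = 0
  · exact ⟨σ, Or.inl (hσ ▸ h'.isTypeZero h0)⟩
  have h1 : (cyclicMatrix a).det ≠ 1 := by
    rw [det_cyclicMatrix, Ne, add_eq_left]
    exact mul_ne_zero (pow_ne_zero _ (by norm_num)) (Finset.prod_ne_zero_iff.2 fun i _ => ha i)
  by_cases h2 : (cyclicMatrix a).det = 2
  · exact ⟨σ, Or.inr (Or.inr (Or.inl (hσ ▸ h'.isTypeTwo h2)))⟩
  obtain ⟨i, hi, hj⟩ := h'.exists_eq_one h0 h1 h2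
  -- A rotation of the indices keeps the cyclic shape and moves the entry `b i = 1` to position `0`.
  have h3 := h'.submatrix (Equiv.addRight i)
  have hdet := Matrix.det_submatrix_equiv_self (Equiv.addRight i) (cyclicMatrix a)
  rw [cyclicMatrix_submatrix_addRight] at h3 hdet
  rw [← hdet] at h0 h1 h2
  refine ⟨(Equiv.addRight i).trans σ, Or.inr (Or.inr (Or.inr ?_))⟩
  have h4 := h3.isTypeThree (by simpa using hi) (fun j hj0 => hj (j + i) (by simpa using hj0))
    h0 h1 h2
  rw [← cyclicMatrix_submatrix_addRight, ← hσ, Matrix.submatrix_submatrix] at h4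
  exact h4

end CutCube

theorem proposition3p3 (n : ℕ) (hn : 2 ≤ n)
    (Δ : CutCube.SimplicialFan (CutCube.Vertex n) n)
    (hover : Δ.complex = CutCube.cutCubeComplex n)
    (hcomplete : Δ.IsComplete) (hnonsing : Δ.IsNonsingular) :
    (∃! p : Matrix (Fin n) (Fin n) ℤ × (Fin n → ℤ), CutCube.IsAssociated Δ.vec p.1 p.2) ∧
    ∀ (A : Matrix (Fin n) (Fin n) ℤ) (b : Fin n → ℤ), CutCube.IsAssociated Δ.vec A b →
      ∃ σ : Equiv.Perm (Fin n),
        CutCube.IsTypeZero (A.submatrix σ σ) (b ∘ σ) ∨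
        CutCube.IsTypeOne (A.submatrix σ σ) (b ∘ σ) ∨
        CutCube.IsTypeTwo (A.submatrix σ σ) (b ∘ σ) ∨
        CutCube.IsTypeThree (A.submatrix σ σ) (b ∘ σ) := by
  refine ⟨CutCube.existsUnique_isAssociated (by omega) hnonsing hover, fun A b hA => ?_⟩
  obtain ⟨k, rfl⟩ : ∃ k, n = k + 2 := ⟨n - 2, by omega⟩
  exact (hA.isAdmissible hnonsing hover).exists_type
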